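/- Let $k \ge 3$ be an integer, and let $M(2k)$ be the perfect matching derangement graph: its vertices are the perfect matchings of the complete graph $K_{2k}$, and two distinct perfect matchings are adjacent if and only if they have no edge in common. Then the automorphism group of $M(2k)$ is isomorphic, as a group, to the symmetric group $\mathrm{Sym}(2k)$ on $2k$ points. -/

import Mathlib

/-- The perfect matchings of the complete graph on `2 * k` vertices. -/
abbrev PerfectMatching (k : ℕ) : Type :=
  {P : (SimpleGraph.completeGraph (Fin (2 * k))).Subgraph // P.IsPerfectMatching}

/-- The perfect matching derangement graph `M(2k)`: its vertices are the perfect matchings of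
the complete graph on `2 * k` vertices, two of them being adjacent when they have no edge in common.
The condition `P ≠ Q` only matters for `k = 0`. -/
def matchingDerangementGraph (k : ℕ) : SimpleGraph (PerfectMatching k) where
  Adj P Q := P ≠ Q ∧ Disjoint P.1.edgeSet Q.1.edgeSet
  symm := ⟨fun _ _ h => ⟨h.1.symm, h.2.symm⟩⟩
  loopless := ⟨fun _ h => h.1 rfl⟩

/-!
Call the set of all perfect matchings that contain a given edge the star of that edge. The stars are
exactly the independent sets `F` such that any two matchings outside `F` have a common neighbour
in `F`, so every automorphism of the derangement graph permutes the stars, and hence the edges of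
the complete graph. Two stars are disjoint exactly when their edges are distinct and meet, so this
permutation of the edges is an automorphism of the line graph. Four or more pairwise meeting edges
have a common point; hence the edges at a point go to edges at a point, and the automorphism comes
from a permutation of the points.

That such an `F` is a star rests on two observations. If the edges of `P ∈ F` are split into two
parts, then `F` contains all matchings agreeing with `P` on one of the parts: otherwise a common
neighbour in `F` of two counterexamples would be disjoint from `P`. Splitting again while `F` is
known to meet `P` inside the surviving part isolates a single edge. The induction needs four points
outside the part, so the case of six points is treated separately.
-/

theorem exists_notMem_of_card_lt {V : Type*} [Fintype V] {s : Finset V}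
    (hs : s.card < Fintype.card V) : ∃ x, x ∉ s :=
  Finset.exists_not_mem_of_card_lt_enatCard (by simpa using hs)

theorem exists_common_mem_of_pairwise_meet {V : Type*} (s : Finset (Sym2 V)) (hs : 4 ≤ s.card)
    (hmeet : ∀ e ∈ s, ∀ f ∈ s, ∃ v, v ∈ e ∧ v ∈ f) : ∃ x, ∀ e ∈ s, x ∈ e := by
  classical
  obtain ⟨e, he, f, hf, hef⟩ := Finset.one_lt_card.mp (show 1 < s.card by omega)
  obtain ⟨x, hxe, hxf⟩ := hmeet e he f hf
  obtain ⟨y, rfl⟩ := Sym2.mem_iff_exists.mp hxe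
  obtain ⟨z, rfl⟩ := Sym2.mem_iff_exists.mp hxf
  have hyz : y ≠ z := by rintro rfl; exact hef rfl
  have eq_of_notMem : ∀ g ∈ s, x ∉ g → g = s(y, z) := by
    intro g hg hxg
    obtain ⟨v, hv, hvg⟩ := hmeet _ he g hg
    obtain ⟨w, hw, hwg⟩ := hmeet _ hf g hg
    have hvy : v = y := (Sym2.mem_iff.mp hv).resolve_left fun h => hxg (h ▸ hvg)
    have hwz : w = z := (Sym2.mem_iff.mp hw).resolve_left fun h => hxg (h ▸ hwg)
    exact (Sym2.mem_and_mem_iff hyz).mp ⟨hvy ▸ hvg, hwz ▸ hwg⟩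
  obtain ⟨g, hg, hg'⟩ := Finset.exists_mem_notMem_of_card_lt_card
    (s := {s(x, y), s(x, z), s(y, z)}) (Finset.card_le_three.trans_lt (by omega : 3 < s.card))
  simp only [Finset.mem_insert, Finset.mem_singleton, not_or] at hg'
  obtain ⟨hgy, hgz, hgyz⟩ := hg'
  have hxg : x ∈ g := by
    by_contra hxg
    exact hgyz (eq_of_notMem g hg hxg)
  obtain ⟨w, rfl⟩ := Sym2.mem_iff_exists.mp hxg
  refine ⟨x, fun h hh => ?_⟩
  by_contra hxh
  obtain ⟨v, hv, hvh⟩ := hmeet _ hg h hh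
  have hvw : v = w := (Sym2.mem_iff.mp hv).resolve_left fun e => hxh (e ▸ hvh)
  rw [eq_of_notMem h hh hxh, hvw, Sym2.mem_iff] at hvh
  rcases hvh with rfl | rfl
  exacts [hgy rfl, hgz rfl]

open SimpleGraph in
theorem exists_common_mem_lineGraph_embedding {V W : Type*} [Fintype V]
    (hV : 5 ≤ Fintype.card V)
    (ψ : (⊤ : SimpleGraph V).lineGraph ↪g (⊤ : SimpleGraph W).lineGraph) (a : V) :
    ∃ x, ∀ e : (⊤ : SimpleGraph V).edgeSet, a ∈ (e : Sym2 V) → x ∈ (ψ e : Sym2 W) := by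
  classical
  let s : Finset (Sym2 W) :=
    ({e | a ∈ (e : Sym2 V)} : Finset (⊤ : SimpleGraph V).edgeSet).map
      (ψ.toEmbedding.trans (.subtype _))
  have hs : s.card = Fintype.card V - 1 := by
    rw [Finset.card_map, ← complete_graph_degree a, ← card_incidenceFinset_eq_degree]
    refine Finset.card_bij (fun e _ => e) ?_ (by simp) fun e he => ?_
    · simp +contextual [mem_incidenceFinset, incidenceSet]
    · rw [mem_incidenceFinset] at he
      exact ⟨⟨e, he.1⟩, by simpa using he.2, rfl⟩
  obtain ⟨x, hx⟩ := exists_common_mem_of_pairwise_meet s (by omega) (by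
    simp only [s, Finset.forall_mem_map, Finset.mem_filter_univ]
    intro e he f hf
    by_cases hef : e = f
    · exact ⟨_, Sym2.out_fst_mem _, hef ▸ Sym2.out_fst_mem _⟩
    · exact (lineGraph_adj_iff_exists.mp
        (ψ.map_adj_iff.mpr (lineGraph_adj_iff_exists.mpr ⟨hef, a, he, hf⟩))).2)
  exact ⟨x, fun e he => hx _ (Finset.mem_map_of_mem _ (by simpa using he))⟩

open SimpleGraph in
theorem exists_embedding_of_lineGraph_embedding {V W : Type*} [Fintype V]
    (hV : 5 ≤ Fintype.card V)
    (ψ : (⊤ : SimpleGraph V).lineGraph ↪g (⊤ : SimpleGraph W).lineGraph) :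
    ∃ σ : V ↪ W, ∀ e, (ψ e : Sym2 W) = (e : Sym2 V).map σ := by
  classical
  choose σ hσ using exists_common_mem_lineGraph_embedding hV ψ
  have hinj : Function.Injective σ := by
    intro a b hab
    by_contra hne
    obtain ⟨c, hc⟩ := exists_notMem_of_card_lt (s := {a, b})
      (Finset.card_le_two.trans_lt (by omega : 2 < Fintype.card V))
    obtain ⟨d, hd⟩ := exists_notMem_of_card_lt (s := {a, b, c})
      (Finset.card_le_three.trans_lt (by omega : 3 < Fintype.card V))
    simp only [Finset.mem_insert, Finset.mem_singleton, not_or] at hc hd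
    obtain ⟨hca, hcb⟩ := hc
    obtain ⟨hda, hdb, hdc⟩ := hd
    let e : (⊤ : SimpleGraph V).edgeSet := ⟨s(a, c), Ne.symm hca⟩
    let f : (⊤ : SimpleGraph V).edgeSet := ⟨s(b, d), Ne.symm hdb⟩
    have hmeet : ∀ v ∈ s(a, c), v ∉ s(b, d) := by
      simp only [Sym2.mem_iff, not_or, forall_eq_or_imp, forall_eq]
      exact ⟨⟨hne, Ne.symm hda⟩, hcb, Ne.symm hdc⟩
    have hef : e ≠ f := by
      intro hef
      have hval : s(a, c) = s(b, d) := congrArg Subtype.val hef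
      exact hmeet a (Sym2.mem_mk_left a c) (hval ▸ Sym2.mem_mk_left a c)
    have hadj : (⊤ : SimpleGraph V).lineGraph.Adj e f :=
      ψ.map_adj_iff.mp <| lineGraph_adj_iff_exists.mpr ⟨ψ.injective.ne hef, σ a,
        hσ a e (Sym2.mem_mk_left a c), hab ▸ hσ b f (Sym2.mem_mk_left b d)⟩
    obtain ⟨-, v, hve, hvf⟩ := lineGraph_adj_iff_exists.mp hadj
    exact hmeet v hve hvf
  refine ⟨⟨σ, hinj⟩, ?_⟩
  rintro ⟨⟨a, b⟩, hab⟩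
  exact (Sym2.mem_and_mem_iff (hinj.ne hab)).mp
    ⟨hσ a _ (Sym2.mem_mk_left a b), hσ b _ (Sym2.mem_mk_right a b)⟩

/-- The fixed-point-free involutions of `V`, which encode the perfect matchings of the complete
graph on `V`: the involution sends each point to its partner. -/
@[ext]
structure FixedPointFreeInvolution (V : Type*) where
  toFun : V → V
  involutive' : Function.Involutive toFun
  apply_ne' : ∀ x, toFun x ≠ x

namespace FixedPointFreeInvolution

variable {V : Type*}

instance : FunLike (FixedPointFreeInvolution V) V V where
  coe := toFun
  coe_injective _ _ := FixedPointFreeInvolution.ext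

theorem involutive (P : FixedPointFreeInvolution V) : Function.Involutive P :=
  P.involutive'

theorem apply_ne (P : FixedPointFreeInvolution V) (x : V) : P x ≠ x :=
  P.apply_ne' x

theorem apply_eq_comm (P : FixedPointFreeInvolution V) {x y : V} : P x = y ↔ P y = x :=
  P.involutive.eq_iff.trans eq_comm

theorem apply_partner_eq_iff {P Q : FixedPointFreeInvolution V} {x : V} :
    Q (P x) = P (P x) ↔ Q x = P x := by
  rw [P.involutive, Q.apply_eq_comm]

theorem even_card_of_mapsTo (P : FixedPointFreeInvolution V) {A : Finset V}
    (hA : ∀ x ∈ A, P x ∈ A) : Even A.card := by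
  have h : ∑ _x ∈ A, (1 : ZMod 2) = 0 :=
    Finset.sum_involution (fun x _ => P x) (fun _ _ => by decide) (fun x _ _ => P.apply_ne x)
      hA (fun x _ => P.involutive x)
  rw [← ZMod.natCast_eq_zero_iff_even]
  simpa using h

instance : MulAction (Equiv.Perm V) (FixedPointFreeInvolution V) where
  smul σ P :=
    { toFun := fun x => σ (P (σ⁻¹ x))
      involutive' := fun x => by simp [P.involutive _]
      apply_ne' := fun x h => P.apply_ne (σ⁻¹ x) (Equiv.Perm.eq_inv_iff_eq.mpr h) }
  one_smul _ := rfl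
  mul_smul _ _ _ := rfl

theorem smul_apply (σ : Equiv.Perm V) (P : FixedPointFreeInvolution V) (x : V) :
    (σ • P) x = σ (P (σ⁻¹ x)) :=
  rfl

theorem smul_apply_apply (σ : Equiv.Perm V) (P : FixedPointFreeInvolution V) (x : V) :
    (σ • P) (σ x) = σ (P x) := by
  simp [smul_apply]

section Rematch

variable [DecidableEq V]

/-- The matching obtained from `P` by joining `a` to `b`, and the former partner of `a` to the
former partner of `b`. -/
def rematch (P : FixedPointFreeInvolution V) (a b : V) : FixedPointFreeInvolution V :=
  Equiv.swap (P a) b • P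

theorem rematch_apply_left (P : FixedPointFreeInvolution V) {a b : V} (hab : a ≠ b) :
    P.rematch a b a = b := by
  rw [rematch, smul_apply, Equiv.swap_inv, Equiv.swap_apply_of_ne_of_ne (P.apply_ne a).symm hab,
    Equiv.swap_apply_left]

theorem rematch_apply_right (P : FixedPointFreeInvolution V) {a b : V} (hab : a ≠ b) :
    P.rematch a b b = a :=
  (apply_eq_comm _).mp (P.rematch_apply_left hab)

theorem rematch_apply_of_ne (P : FixedPointFreeInvolution V) {a b x : V} (hxa : x ≠ a)
    (hxb : x ≠ b) (hPxa : P x ≠ a) (hPxb : P x ≠ b) : P.rematch a b x = P x := by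
  rw [rematch, smul_apply, Equiv.swap_inv,
    Equiv.swap_apply_of_ne_of_ne (fun h => hPxa (P.apply_eq_comm.mp h.symm)) hxb,
    Equiv.swap_apply_of_ne_of_ne (P.involutive.injective.ne hxa) hPxb]

end Rematch

/-- The matchings containing all edges of `P` that meet `A`. -/
def agreeOn (P : FixedPointFreeInvolution V) (A : Finset V) : Set (FixedPointFreeInvolution V) :=
  {R | ∀ x ∈ A, R x = P x}

theorem apply_notMem (P : FixedPointFreeInvolution V) {A : Finset V} (hA : ∀ x ∈ A, P x ∈ A)
    {x : V} (hx : x ∉ A) : P x ∉ A :=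
  fun h => hx (P.involutive x ▸ hA _ h)

theorem rematch_mem_agreeOn [DecidableEq V] (P : FixedPointFreeInvolution V) {A : Finset V}
    (hA : ∀ x ∈ A, P x ∈ A) {a b : V} (ha : a ∉ A) (hb : b ∉ A) : P.rematch a b ∈ P.agreeOn A :=
  fun x hx => P.rematch_apply_of_ne (ne_of_mem_of_not_mem hx ha) (ne_of_mem_of_not_mem hx hb)
    (ne_of_mem_of_not_mem (hA x hx) ha) (ne_of_mem_of_not_mem (hA x hx) hb)

theorem mapsTo_insert_insert [DecidableEq V] (P : FixedPointFreeInvolution V) {A : Finset V}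
    (hA : ∀ x ∈ A, P x ∈ A) {x y : V} (hxy : P x = y) :
    ∀ v ∈ insert x (insert y A), P v ∈ insert x (insert y A) := by
  have hyx := P.apply_eq_comm.mp hxy
  grind

theorem card_insert_insert [DecidableEq V] (P : FixedPointFreeInvolution V) {A : Finset V}
    (hA : ∀ x ∈ A, P x ∈ A) {x y : V} (hxy : P x = y) (hx : x ∉ A) :
    (insert x (insert y A)).card = A.card + 2 := by
  subst hxy
  rw [Finset.card_insert_of_notMem (by simp [hx, (P.apply_ne x).symm]),
    Finset.card_insert_of_notMem (P.apply_notMem hA hx)]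

theorem mapsTo_of_mem_agreeOn {P R : FixedPointFreeInvolution V} {A : Finset V}
    (hA : ∀ x ∈ A, P x ∈ A) (hR : R ∈ P.agreeOn A) : ∀ x ∈ A, R x ∈ A :=
  fun x hx => (hR x hx).symm ▸ hA x hx

theorem agreeOn_subset_agreeOn {P R : FixedPointFreeInvolution V} {A B : Finset V} (hAB : A ⊆ B)
    (hR : R ∈ P.agreeOn A) : R.agreeOn B ⊆ P.agreeOn A :=
  fun _ hS x hx => (hS x (hAB hx)).trans (hR x hx)

/- If `y` is `x` or `f x` this is involutivity; otherwise `f y` and `g y` are both the one point of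
`S` left over. -/
theorem eq_apply_of_card_eq_four {S : Finset V} (hS : S.card = 4) {f g : V → V}
    (hf : f.Involutive) (hg : g.Involutive) {x y : V} (hx : x ∈ S) (hfx : f x ∈ S)
    (hxne : f x ≠ x) (hfg : f x = g x) (hy : y ∈ S) (hfy : f y ∈ S) (hfyne : f y ≠ y)
    (hgy : g y ∈ S) (hgyne : g y ≠ y) : f y = g y := by
  classical
  by_cases hyx : y = x
  · rw [hyx, hfg]
  by_cases hyfx : y = f x
  · rw [hyfx, hf, hfg, hg]
  have hrest : (((S.erase x).erase (f x)).erase y).card ≤ 1 := by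
    rw [Finset.card_erase_of_mem, Finset.card_erase_of_mem, Finset.card_erase_of_mem hx, hS]
    · exact Finset.mem_erase.mpr ⟨hxne, hfx⟩
    · simp [hyx, hyfx, hy]
  refine Finset.card_le_one.mp hrest _ ?_ _ ?_
  · simp only [Finset.mem_erase]
    exact ⟨hfyne, hf.injective.ne hyx, fun h => hyfx (hf.eq_iff.mp h), hfy⟩
  · simp only [Finset.mem_erase]
    exact ⟨hgyne, hfg ▸ hg.injective.ne hyx, fun h => hyfx (hfg ▸ hg.eq_iff.mp h), hgy⟩

theorem eq_apply_of_agree_of_card_eq_four {S : Finset V} (hS : S.card = 4)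
    {R R' : FixedPointFreeInvolution V} (hR : ∀ x ∈ S, R x ∈ S) (hR' : ∀ x ∈ S, R' x ∈ S)
    {f : V → V} (hf : f.Involutive) {x y : V} (hx : x ∈ S) (hRx : R x = f x) (hy : y ∈ S)
    (hRy : R' y = f y) {a : V} (ha : a ∈ S) : R a = R' a := by
  have hyf : R y = f y :=
    eq_apply_of_card_eq_four hS R.involutive hf hx (hR x hx) (R.apply_ne x) hRx hy (hR y hy)
      (R.apply_ne y) (hRy ▸ hR' y hy) (hRy ▸ R'.apply_ne y)
  exact eq_apply_of_card_eq_four hS R.involutive R'.involutive hy (hR y hy) (R.apply_ne y)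
    (hyf.trans hRy.symm) ha (hR a ha) (R.apply_ne a) (hR' a ha) (R'.apply_ne a)

section Avoiding

variable [Fintype V] {f g : V → V}

theorem eq_of_rematch_agree [DecidableEq V] (hf : f.Involutive) (P : FixedPointFreeInvolution V)
    {A : Finset V} (hA : ∀ x ∈ A, P x ∈ A) (hcard : Fintype.card V = A.card + 4) {a y z : V}
    (ha : a ∉ A) (hy : y ∉ A) (hz : z ∉ A) (hay : a ≠ y) (haz : a ≠ z)
    (hyf : ∃ x ∉ A, P.rematch a y x = f x) (hzf : ∃ x ∉ A, P.rematch a z x = f x) : y = z := by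
  obtain ⟨x, hx, hyf⟩ := hyf
  obtain ⟨w, hw, hzf⟩ := hzf
  have hS : Aᶜ.card = 4 := by rw [Finset.card_compl]; omega
  have mapsTo_compl {b : V} (hb : b ∉ A) : ∀ v ∈ Aᶜ, P.rematch a b v ∈ Aᶜ := fun v hv => by
    rw [Finset.mem_compl] at hv ⊢
    exact apply_notMem _ (mapsTo_of_mem_agreeOn hA (P.rematch_mem_agreeOn hA ha hb)) hv
  rw [← P.rematch_apply_left hay, ← P.rematch_apply_left haz]
  exact eq_apply_of_agree_of_card_eq_four hS (mapsTo_compl hy) (mapsTo_compl hz) hf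
    (Finset.mem_compl.mpr hx) hyf (Finset.mem_compl.mpr hw) hzf (Finset.mem_compl.mpr ha)

/- The three matchings of the four-point set `Aᶜ` are pairwise disjoint, so `f` and `g` each meet at
most one of them. -/
theorem exists_mem_agreeOn_avoiding_of_card_eq (hf : f.Involutive) (hg : g.Involutive)
    (P : FixedPointFreeInvolution V) {A : Finset V} (hA : ∀ x ∈ A, P x ∈ A)
    (hcard : Fintype.card V = A.card + 4) :
    ∃ R ∈ P.agreeOn A, ∀ x ∉ A, R x ≠ f x ∧ R x ≠ g x := by
  classical
  obtain ⟨a, ha⟩ := exists_notMem_of_card_lt (show A.card < Fintype.card V by omega)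
  let meeting (h : V → V) : Finset V := {y ∈ Aᶜ.erase a | ∃ x ∉ A, P.rematch a y x = h x}
  have card_meeting (h : V → V) (hh : h.Involutive) : (meeting h).card ≤ 1 := by
    refine Finset.card_le_one.mpr fun y hy z hz => ?_
    simp only [meeting, Finset.mem_filter, Finset.mem_erase, Finset.mem_compl] at hy hz
    exact P.eq_of_rematch_agree hh hA hcard ha hy.1.2 hz.1.2 hy.1.1.symm hz.1.1.symm hy.2 hz.2
  obtain ⟨y, hy, hyfg⟩ : ∃ y ∈ Aᶜ.erase a, y ∉ meeting f ∪ meeting g := by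
    apply Finset.exists_mem_notMem_of_card_lt_card
    rw [Finset.card_erase_of_mem (Finset.mem_compl.mpr ha), Finset.card_compl]
    have := Finset.card_union_le (meeting f) (meeting g)
    have := card_meeting f hf
    have := card_meeting g hg
    omega
  simp only [meeting, Finset.mem_union, Finset.mem_filter, hy, true_and, not_or, not_exists,
    not_and] at hyfg
  exact ⟨P.rematch a y,
    P.rematch_mem_agreeOn hA ha (Finset.mem_compl.mp (Finset.mem_of_mem_erase hy)),
    fun x hx => ⟨hyfg.1 x hx, hyfg.2 x hx⟩⟩

theorem exists_mem_agreeOn_avoiding (hf : f.Involutive) (hg : g.Involutive)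
    (P : FixedPointFreeInvolution V) {A : Finset V} (hA : ∀ x ∈ A, P x ∈ A)
    (hcard : A.card + 4 ≤ Fintype.card V) :
    ∃ R ∈ P.agreeOn A, ∀ x ∉ A, R x ≠ f x ∧ R x ≠ g x := by
  classical
  obtain ⟨n, hn⟩ : ∃ n, Fintype.card V = A.card + 4 + 2 * n := by
    obtain ⟨i, hi⟩ := P.even_card_of_mapsTo hA
    obtain ⟨j, hj⟩ := P.even_card_of_mapsTo (A := Finset.univ) (by simp)
    rw [Finset.card_univ] at hj
    exact ⟨j - i - 2, by omega⟩
  induction n generalizing P A with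
  | zero => exact exists_mem_agreeOn_avoiding_of_card_eq hf hg P hA hn
  | succ n ih =>
    obtain ⟨x, hx⟩ := exists_notMem_of_card_lt (show A.card < Fintype.card V by omega)
    obtain ⟨y, hy⟩ := exists_notMem_of_card_lt (s := A ∪ {x, f x, g x}) <| by
      have := Finset.card_union_le A {x, f x, g x}
      have : ({x, f x, g x} : Finset V).card ≤ 3 := Finset.card_le_three
      omega
    simp only [Finset.mem_union, Finset.mem_insert, Finset.mem_singleton, not_or] at hy
    obtain ⟨hyA, hyx, hyf, hyg⟩ := hy
    have hP' := P.rematch_mem_agreeOn hA hx hyA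
    have hxy := P.rematch_apply_left (Ne.symm hyx)
    have hyx' := P.rematch_apply_right (Ne.symm hyx)
    have hA' := mapsTo_of_mem_agreeOn hA hP'
    have hcardB := card_insert_insert _ hA' hxy hx
    obtain ⟨R, hR, hRfg⟩ := ih (P.rematch x y) (A := insert x (insert y A))
      (mapsTo_insert_insert _ hA' hxy) (by omega) (by omega)
    refine ⟨R, agreeOn_subset_agreeOn (by grind) hP' hR, fun v hv => ?_⟩
    have hRx : R x = y := (hR x (by simp)).trans hxy
    have hRy : R y = x := (hR y (by simp)).trans hyx'
    by_cases hvx : v = x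
    · rw [hvx, hRx]
      exact ⟨hyf, hyg⟩
    by_cases hvy : v = y
    · rw [hvy, hRy]
      exact ⟨fun h => hyf (hf.eq_iff.mp h.symm), fun h => hyg (hg.eq_iff.mp h.symm)⟩
    exact hRfg v (by simp [hvx, hvy, hv])

end Avoiding

/-- The star of `e`: the matchings that contain the edge `e`. It is empty if `e` is a loop. -/
def withEdge (e : Sym2 V) : Set (FixedPointFreeInvolution V) :=
  {P | ∃ x, s(x, P x) = e}

theorem mem_withEdge {P : FixedPointFreeInvolution V} {a b : V} :
    P ∈ withEdge s(a, b) ↔ P a = b := by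
  refine ⟨?_, fun h => ⟨a, by rw [h]⟩⟩
  rintro ⟨x, hx⟩
  rcases Sym2.eq_iff.mp hx with ⟨rfl, rfl⟩ | ⟨rfl, rfl⟩
  exacts [rfl, P.involutive x]

theorem mem_withEdge_apply (P : FixedPointFreeInvolution V) (x : V) : P ∈ withEdge s(x, P x) :=
  ⟨x, rfl⟩

theorem withEdge_nonempty [Nonempty (FixedPointFreeInvolution V)] {a b : V} (hab : a ≠ b) :
    (withEdge s(a, b)).Nonempty := by
  classical
  obtain ⟨P⟩ := ‹Nonempty (FixedPointFreeInvolution V)›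
  exact ⟨P.rematch a b, mem_withEdge.mpr (P.rematch_apply_left hab)⟩

theorem agreeOn_pair [DecidableEq V] (P : FixedPointFreeInvolution V) (a : V) :
    P.agreeOn {a, P a} = withEdge s(a, P a) := by
  ext R
  have h : R a = P a → R (P a) = a := R.apply_eq_comm.mp
  simpa [agreeOn, mem_withEdge, P.involutive a] using h

theorem mapsTo_pair [DecidableEq V] (P : FixedPointFreeInvolution V) (a : V) :
    ∀ x ∈ ({a, P a} : Finset V), P x ∈ ({a, P a} : Finset V) :=
  P.mapsTo_insert_insert (A := ∅) (by simp) rfl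

theorem exists_mem_withEdge_avoiding [Fintype V] [Nonempty (FixedPointFreeInvolution V)]
    (hV : 6 ≤ Fintype.card V) {f g : V → V} (hf : f.Involutive) (hg : g.Involutive) {a b : V}
    (hab : a ≠ b) (hfab : f a ≠ b) (hgab : g a ≠ b) :
    ∃ R ∈ withEdge s(a, b), ∀ x, R x ≠ f x ∧ R x ≠ g x := by
  classical
  obtain ⟨P, hP⟩ := withEdge_nonempty hab
  obtain rfl := mem_withEdge.mp hP
  obtain ⟨R, hR, hRfg⟩ := exists_mem_agreeOn_avoiding hf hg P (P.mapsTo_pair a)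
    (by have := Finset.card_le_two (a := a) (b := P a); omega)
  have hRa : R a = P a := hR a (by simp)
  have hRPa : R (P a) = a := R.apply_eq_comm.mp hRa
  refine ⟨R, mem_withEdge.mpr hRa, fun x => ?_⟩
  by_cases hxa : x = a
  · rw [hxa, hRa]
    exact ⟨hfab.symm, hgab.symm⟩
  by_cases hxPa : x = P a
  · rw [hxPa, hRPa]
    exact ⟨fun h => hfab (hf.eq_iff.mp h.symm).symm, fun h => hgab (hg.eq_iff.mp h.symm).symm⟩
  exact hRfg x (by simp [hxa, hxPa])

end FixedPointFreeInvolution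

/-- An independent set `F` such that any two vertices outside `F` have a common neighbour in `F`.
In the derangement graph of perfect matchings these are the stars of the edges. -/
structure IsPairDominatingCoclique {α : Type*} (G : SimpleGraph α) (F : Set α) : Prop where
  isIndepSet : G.IsIndepSet F
  exists_adj : ∀ u ∉ F, ∀ v ∉ F, ∃ w ∈ F, G.Adj w u ∧ G.Adj w v

namespace IsPairDominatingCoclique

variable {α β : Type*} {G : SimpleGraph α} {H : SimpleGraph β} {F : Set α}

theorem nonempty [Nonempty α] (hF : IsPairDominatingCoclique G F) : F.Nonempty := by
  obtain ⟨u⟩ := ‹Nonempty α›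
  by_cases hu : u ∈ F
  · exact ⟨u, hu⟩
  · obtain ⟨w, hw, -⟩ := hF.exists_adj u hu u hu
    exact ⟨w, hw⟩

theorem image (hF : IsPairDominatingCoclique G F) (φ : G ≃g H) :
    IsPairDominatingCoclique H (φ '' F) where
  isIndepSet := by
    rintro _ ⟨u, hu, rfl⟩ _ ⟨v, hv, rfl⟩ huv
    rw [φ.map_adj_iff]
    exact hF.isIndepSet hu hv fun h => huv (congrArg φ h)
  exists_adj := φ.surjective.forall.mpr fun u hu => φ.surjective.forall.mpr fun v hv => by
    rw [φ.injective.mem_set_image] at hu hv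
    obtain ⟨w, hw, hwu, hwv⟩ := hF.exists_adj u hu v hv
    exact ⟨φ w, Set.mem_image_of_mem φ hw, φ.map_adj_iff.mpr hwu, φ.map_adj_iff.mpr hwv⟩

end IsPairDominatingCoclique

namespace FixedPointFreeInvolution

variable {V : Type*}

/-- The perfect matching derangement graph on the point set `V`: two perfect matchings are adjacent
when no point has the same partner in both. The condition `P ≠ Q` only matters for empty `V`. -/
def derangementGraph (V : Type*) : SimpleGraph (FixedPointFreeInvolution V) where
  Adj P Q := P ≠ Q ∧ ∀ x, P x ≠ Q x
  symm := ⟨fun _ _ h => ⟨h.1.symm, fun x => (h.2 x).symm⟩⟩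
  loopless := ⟨fun _ h => h.1 rfl⟩

theorem derangementGraph_adj [Nonempty V] {P Q : FixedPointFreeInvolution V} :
    (derangementGraph V).Adj P Q ↔ ∀ x, P x ≠ Q x := by
  refine and_iff_right_of_imp fun h hPQ => ?_
  obtain ⟨x⟩ := ‹Nonempty V›
  exact h x (hPQ ▸ rfl)

section Classification

variable {F : Set (FixedPointFreeInvolution V)} {P Q : FixedPointFreeInvolution V}

theorem exists_apply_eq_of_isIndepSet [Nonempty V] (hF : (derangementGraph V).IsIndepSet F)
    (hP : P ∈ F) (hQ : Q ∈ F) : ∃ x, P x = Q x := by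
  by_cases hPQ : P = Q
  · exact ⟨Classical.arbitrary V, hPQ ▸ rfl⟩
  · simpa [derangementGraph_adj] using hF hP hQ hPQ

theorem agreeOn_subset_or_agreeOn_subset [DecidableEq V]
    (hF : IsPairDominatingCoclique (derangementGraph V) F) {A B : Finset V}
    (hAB : ∀ Q ∈ F, ∃ x ∈ A ∪ B, Q x = P x) : P.agreeOn A ⊆ F ∨ P.agreeOn B ⊆ F := by
  by_contra! h
  obtain ⟨⟨Q₁, hQ₁, hQ₁F⟩, ⟨Q₂, hQ₂, hQ₂F⟩⟩ := h.imp Set.not_subset.mp Set.not_subset.mp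
  obtain ⟨R, hRF, hR₁, hR₂⟩ := hF.exists_adj Q₁ hQ₁F Q₂ hQ₂F
  obtain ⟨x, hx, hRx⟩ := hAB R hRF
  rcases Finset.mem_union.mp hx with hx | hx
  · exact hR₁.2 x (hRx.trans (hQ₁ x hx).symm)
  · exact hR₂.2 x (hRx.trans (hQ₂ x hx).symm)

theorem exists_mem_apply_ne_of_not_withEdge_subset
    (hF : IsPairDominatingCoclique (derangementGraph V) F) {b c : V}
    (hb : ¬ withEdge s(b, P b) ⊆ F) (hc : ¬ withEdge s(c, P c) ⊆ F) :
    ∃ Q ∈ F, Q b ≠ P b ∧ Q c ≠ P c := by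
  obtain ⟨Q₁, hQ₁, hQ₁F⟩ := Set.not_subset.mp hb
  obtain ⟨Q₂, hQ₂, hQ₂F⟩ := Set.not_subset.mp hc
  rw [mem_withEdge] at hQ₁ hQ₂
  obtain ⟨Q, hQF, h₁, h₂⟩ := hF.exists_adj Q₁ hQ₁F Q₂ hQ₂F
  exact ⟨Q, hQF, hQ₁ ▸ h₁.2 b, hQ₂ ▸ h₂.2 c⟩

variable [Fintype V]

theorem isPairDominatingCoclique_withEdge [Nonempty (FixedPointFreeInvolution V)]
    (hV : 6 ≤ Fintype.card V) {a b : V} (hab : a ≠ b) :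
    IsPairDominatingCoclique (derangementGraph V) (withEdge s(a, b)) where
  isIndepSet P hP Q hQ _ hadj :=
    hadj.2 a ((mem_withEdge.mp hP).trans (mem_withEdge.mp hQ).symm)
  exists_adj Q₁ h₁ Q₂ h₂ := by
    have : Nonempty V := ⟨a⟩
    rw [mem_withEdge] at h₁ h₂
    obtain ⟨R, hR, hRQ⟩ :=
      exists_mem_withEdge_avoiding hV Q₁.involutive Q₂.involutive hab h₁ h₂
    exact ⟨R, hR, derangementGraph_adj.mpr fun x => (hRQ x).1,
      derangementGraph_adj.mpr fun x => (hRQ x).2⟩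

theorem exists_apply_eq_of_agreeOn_subset (hF : (derangementGraph V).IsIndepSet F) {A : Finset V}
    (hA : ∀ x ∈ A, P x ∈ A) (hcard : A.card + 4 ≤ Fintype.card V) (hPF : P.agreeOn A ⊆ F)
    (hQ : Q ∈ F) : ∃ x ∈ A, Q x = P x := by
  have : Nonempty V := Fintype.card_pos_iff.mp (by omega)
  obtain ⟨R, hR, hRQ⟩ := exists_mem_agreeOn_avoiding Q.involutive Q.involutive P hA hcard
  obtain ⟨x, hx⟩ := exists_apply_eq_of_isIndepSet hF (hPF hR) hQ
  have hxA : x ∈ A := by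
    by_contra hxA
    exact (hRQ x hxA).1 hx
  exact ⟨x, hxA, hx.symm.trans (hR x hxA)⟩

theorem eq_withEdge_of_subset [Nonempty (FixedPointFreeInvolution V)] (hV : 6 ≤ Fintype.card V)
    (hF : (derangementGraph V).IsIndepSet F) {a b : V} (hab : a ≠ b)
    (hsub : withEdge s(a, b) ⊆ F) : F = withEdge s(a, b) := by
  classical
  refine Set.Subset.antisymm (fun Q hQ => ?_) hsub
  obtain ⟨P, hP⟩ := withEdge_nonempty hab
  obtain rfl := mem_withEdge.mp hP
  obtain ⟨x, hx, hQx⟩ := exists_apply_eq_of_agreeOn_subset hF (P.mapsTo_pair a)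
    (by have := Finset.card_le_two (a := a) (b := P a); omega) (P.agreeOn_pair a ▸ hsub) hQ
  rw [Finset.mem_insert, Finset.mem_singleton] at hx
  rw [mem_withEdge]
  rcases hx with rfl | rfl
  · exact hQx
  · exact Q.apply_eq_comm.mp (hQx.trans (P.involutive a))

theorem exists_withEdge_subset_of_agreeOn_subset
    (hF : IsPairDominatingCoclique (derangementGraph V) F) {A : Finset V}
    (hA : ∀ x ∈ A, P x ∈ A) (hcard : A.card + 4 ≤ Fintype.card V) (hPF : P.agreeOn A ⊆ F) :
    ∃ a, withEdge s(a, P a) ⊆ F := by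
  classical
  induction A using Finset.strongInduction with
  | H A ih =>
    have hmeet : ∀ Q ∈ F, ∃ x ∈ A, Q x = P x := fun Q hQ =>
      exists_apply_eq_of_agreeOn_subset hF.isIndepSet hA hcard hPF hQ
    obtain ⟨a, ha, -⟩ := hmeet P (hPF fun _ _ => rfl)
    have hsub : ({a, P a} : Finset V) ⊆ A := by
      simp [Finset.insert_subset_iff, ha, hA a ha]
    rw [← Finset.union_sdiff_of_subset hsub] at hmeet
    rcases agreeOn_subset_or_agreeOn_subset hF hmeet with h | h
    · exact ⟨a, P.agreeOn_pair a ▸ h⟩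
    · have hss : A \ {a, P a} ⊂ A := Finset.sdiff_ssubset hsub (by simp)
      refine ih _ hss (fun x hx => ?_) (by have := Finset.card_lt_card hss; omega) h
      rw [Finset.mem_sdiff] at hx ⊢
      exact ⟨hA x hx.1, P.apply_notMem (P.mapsTo_pair a) hx.2⟩

theorem exists_card_eq_four [DecidableEq V] (P : FixedPointFreeInvolution V)
    (hV : 4 ≤ Fintype.card V) : ∃ a b, ({b, P b, a, P a} : Finset V).card = 4 := by
  have : Nonempty V := Fintype.card_pos_iff.mp (by omega)
  let a := Classical.arbitrary V
  have hcard : ({a, P a} : Finset V).card = 2 := Finset.card_pair (P.apply_ne a).symm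
  obtain ⟨b, hb⟩ := exists_notMem_of_card_lt (s := {a, P a}) (by omega)
  exact ⟨a, b, by rw [P.card_insert_insert (P.mapsTo_pair a) rfl hb, hcard]⟩

theorem exists_withEdge_subset_of_eight_le_card (hV : 8 ≤ Fintype.card V)
    (hF : IsPairDominatingCoclique (derangementGraph V) F) (hP : P ∈ F) :
    ∃ a, withEdge s(a, P a) ⊆ F := by
  classical
  have : Nonempty V := Fintype.card_pos_iff.mp (by omega)
  obtain ⟨a, b, hcard⟩ := P.exists_card_eq_four (by omega)
  have hA := P.mapsTo_insert_insert (P.mapsTo_pair a) (x := b) rfl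
  set A : Finset V := {b, P b, a, P a}
  have hmeet : ∀ Q ∈ F, ∃ x ∈ A ∪ Aᶜ, Q x = P x := fun Q hQ => by
    simpa using exists_apply_eq_of_isIndepSet hF.isIndepSet hQ hP
  rcases agreeOn_subset_or_agreeOn_subset hF hmeet with h | h
  · exact exists_withEdge_subset_of_agreeOn_subset hF hA (by omega) h
  · refine exists_withEdge_subset_of_agreeOn_subset hF (fun x hx => ?_)
      (by rw [Finset.card_compl]; omega) h
    rw [Finset.mem_compl] at hx ⊢
    exact P.apply_notMem hA hx

theorem exists_three_of_card_eq_six (P : FixedPointFreeInvolution V) (hV : Fintype.card V = 6) :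
    ∃ a b c, ∀ x, x = a ∨ x = P a ∨ x = b ∨ x = P b ∨ x = c ∨ x = P c := by
  classical
  obtain ⟨c, b, hcard⟩ := P.exists_card_eq_four (by omega)
  obtain ⟨a, ha⟩ := exists_notMem_of_card_lt (s := {b, P b, c, P c}) (by omega)
  have huniv : ({a, P a, b, P b, c, P c} : Finset V) = Finset.univ := by
    rw [← Finset.card_eq_iff_eq_univ, P.card_insert_insert
      (P.mapsTo_insert_insert (P.mapsTo_pair c) rfl) rfl ha, hcard, hV]
  exact ⟨a, b, c, fun x => by simpa using huniv.ge (Finset.mem_univ x)⟩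

/- If `P` has the edges `a`, `b`, `c` and no star of one of them lies in `F`, then `F` contains
`Q₁` meeting `P` only in `a` and `Q₂` meeting `P` only in `b`. A common edge of `Q₁` and `Q₂` would
avoid the ends of `a` and `b`, hence be `c`, which neither contains. -/
theorem exists_withEdge_subset_of_card_eq_six (hV : Fintype.card V = 6)
    (hF : IsPairDominatingCoclique (derangementGraph V) F) (hP : P ∈ F) :
    ∃ a, withEdge s(a, P a) ⊆ F := by
  have : Nonempty V := Fintype.card_pos_iff.mp (by omega)
  by_contra! hnot
  obtain ⟨a, b, c, hcover⟩ := P.exists_three_of_card_eq_six hV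
  have meets_edge {Q : FixedPointFreeInvolution V} (hQ : Q ∈ F) :
      Q a = P a ∨ Q b = P b ∨ Q c = P c := by
    obtain ⟨x, hx⟩ := exists_apply_eq_of_isIndepSet hF.isIndepSet hQ hP
    rcases hcover x with rfl | rfl | rfl | rfl | rfl | rfl <;>
      simp_all only [apply_partner_eq_iff, true_or, or_true]
  obtain ⟨Q₁, hQ₁, hQ₁b, hQ₁c⟩ := exists_mem_apply_ne_of_not_withEdge_subset hF (hnot b) (hnot c)
  obtain ⟨Q₂, hQ₂, hQ₂a, hQ₂c⟩ := exists_mem_apply_ne_of_not_withEdge_subset hF (hnot a) (hnot c)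
  have hQ₁a : Q₁ a = P a := (meets_edge hQ₁).resolve_right (not_or_intro hQ₁b hQ₁c)
  have hQ₂b : Q₂ b = P b := ((meets_edge hQ₂).resolve_left hQ₂a).resolve_right hQ₂c
  have eq_or_eq_of_agree {x : V} (hx : Q₁ x = Q₂ x) : x = c ∨ x = P c := by
    rcases hcover x with rfl | rfl | rfl | rfl | h | h
    · exact absurd (hx.symm.trans hQ₁a) hQ₂a
    · exact absurd (apply_partner_eq_iff.mp (hx.symm.trans (apply_partner_eq_iff.mpr hQ₁a))) hQ₂a
    · exact absurd (hx.trans hQ₂b) hQ₁b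
    · exact absurd (apply_partner_eq_iff.mp (hx.trans (apply_partner_eq_iff.mpr hQ₂b))) hQ₁b
    · exact .inl h
    · exact .inr h
  obtain ⟨x, hx⟩ := exists_apply_eq_of_isIndepSet hF.isIndepSet hQ₁ hQ₂
  have hx' : Q₁ (Q₁ x) = Q₂ (Q₁ x) := by rw [Q₁.involutive, hx, Q₂.involutive]
  rcases eq_or_eq_of_agree hx with rfl | rfl <;> rcases eq_or_eq_of_agree hx' with h | h
  · exact Q₁.apply_ne _ h
  · exact hQ₁c h
  · exact hQ₁c (Q₁.apply_eq_comm.mp h)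
  · exact Q₁.apply_ne _ h

theorem exists_eq_withEdge [Nonempty (FixedPointFreeInvolution V)] (hV : 6 ≤ Fintype.card V)
    (hF : IsPairDominatingCoclique (derangementGraph V) F) :
    ∃ e ∈ (⊤ : SimpleGraph V).edgeSet, F = withEdge e := by
  obtain ⟨P, hP⟩ := hF.nonempty
  obtain ⟨a, ha⟩ : ∃ a, withEdge s(a, P a) ⊆ F := by
    obtain ⟨n, hn⟩ := P.even_card_of_mapsTo (A := Finset.univ) (by simp)
    rw [Finset.card_univ] at hn
    rcases (by omega : Fintype.card V = 6 ∨ 8 ≤ Fintype.card V) with h | h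
    · exact exists_withEdge_subset_of_card_eq_six h hF hP
    · exact exists_withEdge_subset_of_eight_le_card h hF hP
  exact ⟨s(a, P a), (P.apply_ne a).symm,
    eq_withEdge_of_subset hV hF.isIndepSet (P.apply_ne a).symm ha⟩

end Classification

section Automorphisms

open SimpleGraph

theorem withEdge_inter_nonempty [Nonempty (FixedPointFreeInvolution V)] {a b c d : V}
    (hab : a ≠ b) (hcd : c ≠ d) (hac : a ≠ c) (had : a ≠ d) (hbc : b ≠ c) (hbd : b ≠ d) :
    (withEdge s(a, b) ∩ withEdge s(c, d)).Nonempty := by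
  classical
  obtain ⟨P, hP⟩ := withEdge_nonempty hab
  obtain rfl := mem_withEdge.mp hP
  exact ⟨P.rematch c d, mem_withEdge.mpr (P.rematch_apply_of_ne hac had hbc hbd),
    mem_withEdge.mpr (P.rematch_apply_left hcd)⟩

theorem disjoint_withEdge_iff [Nonempty (FixedPointFreeInvolution V)]
    {e f : (⊤ : SimpleGraph V).edgeSet} :
    Disjoint (withEdge (e : Sym2 V)) (withEdge (f : Sym2 V)) ↔
      (⊤ : SimpleGraph V).lineGraph.Adj e f := by
  rw [lineGraph_adj_iff_exists]
  constructor
  · intro hdisj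
    obtain ⟨⟨a, b⟩, hab⟩ := e
    obtain ⟨⟨c, d⟩, hcd⟩ := f
    by_contra h
    refine Set.not_disjoint_iff_nonempty_inter.mpr ?_ hdisj
    by_cases hne : s(a, b) = s(c, d)
    · obtain ⟨P, hP⟩ := withEdge_nonempty hab
      exact ⟨P, hP, (congrArg withEdge hne).subset hP⟩
    · have hmeet : ∀ v ∈ s(a, b), v ∉ s(c, d) := fun v hv hv' =>
        h ⟨fun hef => hne (congrArg Subtype.val hef), v, hv, hv'⟩
      simp only [Sym2.mem_iff, not_or, forall_eq_or_imp, forall_eq] at hmeet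
      obtain ⟨⟨hac, had⟩, hbc, hbd⟩ := hmeet
      exact withEdge_inter_nonempty hab hcd hac had hbc hbd
  · rintro ⟨hne, v, hve, hvf⟩
    rw [Set.disjoint_left]
    intro P hPe hPf
    obtain ⟨y, he⟩ := Sym2.mem_iff_exists.mp hve
    obtain ⟨z, hf⟩ := Sym2.mem_iff_exists.mp hvf
    rw [he, mem_withEdge] at hPe
    rw [hf, mem_withEdge] at hPf
    exact hne (Subtype.ext (by rw [he, hf, ← hPe, hPf]))

theorem eq_of_withEdge_subset [Fintype V] [Nonempty (FixedPointFreeInvolution V)]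
    (hV : 6 ≤ Fintype.card V) {a b c d : V} (hab : a ≠ b)
    (h : withEdge s(a, b) ⊆ withEdge s(c, d)) : s(a, b) = s(c, d) := by
  classical
  by_contra hne
  have hswap : Equiv.swap c d a ≠ b := by
    rintro rfl
    rcases eq_or_ne a c with rfl | hac
    · exact hne (by rw [Equiv.swap_apply_left])
    rcases eq_or_ne a d with rfl | had
    · exact hne (by rw [Equiv.swap_apply_right, Sym2.eq_swap])
    exact hab (Equiv.swap_apply_of_ne_of_ne hac had).symm
  have hinv : (Equiv.swap c d : V → V).Involutive := fun x => Equiv.swap_apply_self c d x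
  obtain ⟨R, hR, hRcd⟩ := exists_mem_withEdge_avoiding hV hinv hinv hab hswap hswap
  exact (hRcd c).1 ((mem_withEdge.mp (h hR)).trans (Equiv.swap_apply_left c d).symm)

theorem smul_mem_withEdge {P : FixedPointFreeInvolution V} {e : Sym2 V} (σ : Equiv.Perm V)
    (hP : P ∈ withEdge e) : σ • P ∈ withEdge (e.map σ) := by
  obtain ⟨x, rfl⟩ := hP
  exact mem_withEdge.mpr (smul_apply_apply σ P x)

theorem smul_adj_smul_iff {P Q : FixedPointFreeInvolution V} (σ : Equiv.Perm V) :
    (derangementGraph V).Adj (σ • P) (σ • Q) ↔ (derangementGraph V).Adj P Q := by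
  refine and_congr (MulAction.injective σ).ne_iff ?_
  rw [σ.surjective.forall]
  simp only [smul_apply_apply, σ.injective.ne_iff]

/-- Permutations of the points act on the matchings by graph automorphisms. -/
def permHom (V : Type*) : Equiv.Perm V →* (derangementGraph V ≃g derangementGraph V) where
  toFun σ := ⟨MulAction.toPerm σ, smul_adj_smul_iff σ⟩
  map_one' := RelIso.ext fun P => one_smul (Equiv.Perm V) P
  map_mul' σ τ := RelIso.ext fun P => mul_smul σ τ P

variable [Fintype V] [Nonempty (FixedPointFreeInvolution V)]

theorem permHom_injective (hV : 6 ≤ Fintype.card V) : Function.Injective (permHom V) := by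
  classical
  refine (injective_iff_map_eq_one _).mpr fun σ hσ => Equiv.ext fun a => ?_
  have hsmul (P : FixedPointFreeInvolution V) : σ • P = P := DFunLike.congr_fun hσ P
  obtain ⟨b, hb⟩ := exists_notMem_of_card_lt (s := {a, σ a})
    (Finset.card_le_two.trans_lt (by omega : 2 < Fintype.card V))
  simp only [Finset.mem_insert, Finset.mem_singleton, not_or] at hb
  have hedge : s(a, b) = s(σ a, σ b) := eq_of_withEdge_subset hV (Ne.symm hb.1)
    fun P hP => hsmul P ▸ smul_mem_withEdge σ hP
  exact (Sym2.mem_iff.mp (hedge ▸ Sym2.mem_mk_left (σ a) (σ b))).resolve_right (Ne.symm hb.2)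

theorem exists_lineGraph_embedding (hV : 6 ≤ Fintype.card V)
    (φ : derangementGraph V ≃g derangementGraph V) :
    ∃ ψ : (⊤ : SimpleGraph V).lineGraph ↪g (⊤ : SimpleGraph V).lineGraph,
      ∀ e : (⊤ : SimpleGraph V).edgeSet, φ '' withEdge (e : Sym2 V) = withEdge (ψ e : Sym2 V) := by
  have image_withEdge (e : (⊤ : SimpleGraph V).edgeSet) :
      ∃ f : (⊤ : SimpleGraph V).edgeSet, φ '' withEdge (e : Sym2 V) = withEdge (f : Sym2 V) := by
    obtain ⟨⟨a, b⟩, hab⟩ := e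
    obtain ⟨f, hf, hφ⟩ :=
      exists_eq_withEdge hV ((isPairDominatingCoclique_withEdge hV hab).image φ)
    exact ⟨⟨f, hf⟩, hφ⟩
  choose ψ hψ using image_withEdge
  have hinj : Function.Injective ψ := by
    rintro ⟨⟨a, b⟩, hab⟩ ⟨⟨c, d⟩, hcd⟩ h
    have himage := (hψ ⟨s(a, b), hab⟩).trans (h ▸ (hψ ⟨s(c, d), hcd⟩).symm)
    exact Subtype.ext (eq_of_withEdge_subset hV hab (φ.injective.image_injective himage).subset)
  refine ⟨⟨⟨ψ, hinj⟩, fun {e f} => ?_⟩, hψ⟩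
  rw [← disjoint_withEdge_iff, ← disjoint_withEdge_iff]
  exact hψ e ▸ hψ f ▸ Set.disjoint_image_iff φ.injective

theorem permHom_surjective (hV : 6 ≤ Fintype.card V) : Function.Surjective (permHom V) := by
  intro φ
  obtain ⟨ψ, hψ⟩ := exists_lineGraph_embedding hV φ
  obtain ⟨σ, hσ⟩ := exists_embedding_of_lineGraph_embedding (by omega) ψ
  refine ⟨Equiv.ofBijective σ (Finite.injective_iff_bijective.mp σ.injective),
    RelIso.ext fun P => DFunLike.ext _ _ ?_⟩
  rw [(Finite.injective_iff_surjective.mp σ.injective).forall]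
  intro x
  let e : (⊤ : SimpleGraph V).edgeSet := ⟨s(x, P x), (P.apply_ne x).symm⟩
  have hφP : φ P ∈ withEdge s(σ x, σ (P x)) := by
    have := hψ e ▸ Set.mem_image_of_mem φ (P.mem_withEdge_apply x)
    rwa [hσ] at this
  exact (smul_apply_apply _ P x).trans (mem_withEdge.mp hφP).symm

end Automorphisms

section PerfectMatching

open SimpleGraph

/-- The edges of the matching `P`, as a spanning subgraph of the complete graph. -/
def toSubgraph (P : FixedPointFreeInvolution V) : (completeGraph V).Subgraph where
  verts := Set.univ
  Adj x y := P x = y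
  adj_sub {x _} h := fun hxy => P.apply_ne x (h.trans hxy.symm)
  edge_vert _ := Set.mem_univ _
  symm := ⟨fun _ _ => P.apply_eq_comm.mp⟩

theorem isPerfectMatching_toSubgraph (P : FixedPointFreeInvolution V) :
    P.toSubgraph.IsPerfectMatching :=
  Subgraph.isPerfectMatching_iff.mpr fun x => ⟨P x, rfl, fun _ h => Eq.symm h⟩

theorem toSubgraph_injective :
    Function.Injective (toSubgraph : FixedPointFreeInvolution V → _) := by
  intro P Q h
  refine DFunLike.ext _ _ fun x => ?_
  have hPx : P.toSubgraph.Adj x (P x) := rfl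
  rw [h] at hPx
  exact Eq.symm hPx

theorem exists_toSubgraph_eq {M : (completeGraph V).Subgraph} (hM : M.IsPerfectMatching) :
    ∃ P : FixedPointFreeInvolution V, P.toSubgraph = M := by
  choose f hf hunique using Subgraph.isPerfectMatching_iff.mp hM
  refine ⟨⟨f, fun x => (hunique _ _ (hf x).symm).symm, fun x => (hf x).ne.symm⟩,
    Subgraph.ext hM.2.verts_eq_univ.symm ?_⟩
  ext x y
  exact ⟨fun h => h ▸ hf x, fun h => (hunique _ _ h).symm⟩

theorem disjoint_edgeSet_toSubgraph {P Q : FixedPointFreeInvolution V} :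
    Disjoint P.toSubgraph.edgeSet Q.toSubgraph.edgeSet ↔ ∀ x, P x ≠ Q x := by
  rw [Set.disjoint_left, Sym2.forall]
  exact ⟨fun h x hx => h x (P x) rfl hx.symm, fun h x _ hP hQ => h x (Eq.trans hP (Eq.symm hQ))⟩

/-- The isomorphism onto `M(2k)` that turns an involution into the matching joining each point to
its image. -/
noncomputable def derangementGraphIso (k : ℕ) :
    derangementGraph (Fin (2 * k)) ≃g matchingDerangementGraph k where
  toEquiv := Equiv.ofBijective (fun P => ⟨P.toSubgraph, P.isPerfectMatching_toSubgraph⟩)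
    ⟨fun _ _ h => toSubgraph_injective (congrArg Subtype.val h), fun ⟨_, hM⟩ =>
      (exists_toSubgraph_eq hM).imp fun _ h => Subtype.ext h⟩
  map_rel_iff' := and_congr (Equiv.injective _).ne_iff disjoint_edgeSet_toSubgraph

end PerfectMatching

end FixedPointFreeInvolution

/-- Conjugation by an isomorphism of relations, as an isomorphism of automorphism groups. -/
def relIsoAutCongr {α β : Type*} {r : α → α → Prop} {s : β → β → Prop} (e : r ≃r s) :
    (r ≃r r) ≃* (s ≃r s) where
  toFun f := (e.symm.trans f).trans e
  invFun f := (e.trans f).trans e.symm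
  left_inv f := by ext; simp
  right_inv f := by ext; simp
  map_mul' f g := by ext; simp

theorem mainTheorem5 (k : ℕ) (hk : 3 ≤ k) :
    Nonempty ((matchingDerangementGraph k ≃g matchingDerangementGraph k) ≃*
      Equiv.Perm (Fin (2 * k))) := by
  have hV : 6 ≤ Fintype.card (Fin (2 * k)) := by rw [Fintype.card_fin]; omega
  have : Nonempty (FixedPointFreeInvolution (Fin (2 * k))) :=
    ⟨⟨Fin.rev, Fin.rev_rev, fun x hx => by rw [Fin.ext_iff, Fin.val_rev] at hx; omega⟩⟩
  let permEquiv := MulEquiv.ofBijective (FixedPointFreeInvolution.permHom (Fin (2 * k)))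
    ⟨FixedPointFreeInvolution.permHom_injective hV, FixedPointFreeInvolution.permHom_surjective hV⟩
  exact ⟨(permEquiv.trans
    (relIsoAutCongr (FixedPointFreeInvolution.derangementGraphIso k))).symm⟩
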